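/- Let $d \ge 2$ and let $G = \mathbf{SO}(d)$ or $G = \mathbf{O}(d)$, regarded as a subgroup of $\mathrm{GL}(d,\mathbb{R})$. Let $X_d$ denote either the space $C(\mathbb{R}^d)$ of real-valued continuous functions on $\mathbb{R}^d$, or the space $\mathcal{D}(\mathbb{R}^d)'$ of real-valued Schwartz distributions on $\mathbb{R}^d$. For $h \in \mathbb{R}^d$ and $P \in \mathrm{GL}(d,\mathbb{R})$, define operators on $C(\mathbb{R}^d)$, and likewise on the space $\mathcal{D}(\mathbb{R}^d)$ of test functions, by \[ \tau_h(g)(x) = g(x+h), \qquad O_P(g)(x) = g(Px), \] and on $\mathcal{D}(\mathbb{R}^d)'$ by \[ \tau_h(f)\{\phi\} = f\{\tau_{-h}\phi\}, \qquad O_P(f)\{\phi\} = \frac{1}{|\det P|}\, f\{O_{P^{-1}}\phi\}, \qquad \phi \in \mathcal{D}(\mathbb{R}^d). \] Let $V \subseteq X_d$ be a finite-dimensional real vector subspace such that $\tau_h(V) \subseteq V$ for all $h \in \mathbb{R}^d$ and $O_P(V) \subseteq V$ for all $P \in G$. Then every $f \in V$ is an ordinary polynomial in $d$ real variables: there is $p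 \in \mathbb{R}[x_1,\dots,x_d]$ such that $f(x) = p(x)$ for all $x \in \mathbb{R}^d$ if $X_d = C(\mathbb{R}^d)$, and $f\{\phi\} = \int_{\mathbb{R}^d} p(x)\phi(x)\,dx$ for all $\phi \in \mathcal{D}(\mathbb{R}^d)$ if $X_d = \mathcal{D}(\mathbb{R}^d)'$. -/

import Mathlib

open MeasureTheory TopologicalSpace
open scoped Distributions ContDiff CompactConvergenceCLM

noncomputable section

namespace InvariantPoly

/-- `ℝ^d` with its Euclidean structure and Lebesgue measure. -/
abbrev Rd (d : ℕ) : Type := EuclideanSpace ℝ (Fin d)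

/-- The space `C(ℝ^d)` of real-valued continuous functions. -/
abbrev ContFun (d : ℕ) : Type := C(Rd d, ℝ)

/-- The space `𝓓(ℝ^d)` of real-valued smooth compactly supported test functions, with its
canonical LF topology. -/
abbrev Test (d : ℕ) : Type := 𝓓((⊤ : Opens (Rd d)), ℝ)

/-- The space `𝓓(ℝ^d)'` of real-valued distributions, i.e. continuous linear functionals
on `𝓓(ℝ^d)`. -/
abbrev Distr (d : ℕ) : Type := 𝓓'((⊤ : Opens (Rd d)), ℝ)

/-- The orthogonal group `O(d)` as a subgroup of `GL(d, ℝ)`. -/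
def orthogonalSubgroup (d : ℕ) : Subgroup (GL (Fin d) ℝ) :=
  (Matrix.orthogonalGroup (Fin d) ℝ).units

/-- The special orthogonal group `SO(d)` as a subgroup of `GL(d, ℝ)`. -/
def specialOrthogonalSubgroup (d : ℕ) : Subgroup (GL (Fin d) ℝ) :=
  (Matrix.specialOrthogonalGroup (Fin d) ℝ).units

theorem mem_orthogonalSubgroup {d : ℕ} (P : GL (Fin d) ℝ) : P ∈ orthogonalSubgroup d ↔
    (P : Matrix (Fin d) (Fin d) ℝ) * (P : Matrix (Fin d) (Fin d) ℝ).transpose = 1 := by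
  rw [orthogonalSubgroup, Submonoid.mem_units_iff, ← Matrix.mem_orthogonalGroup_iff]
  refine ⟨fun h => h.1, fun h => ⟨h, ?_⟩⟩
  have h1 := (Matrix.mem_orthogonalGroup_iff _ _).1 h
  have h2 : ((P⁻¹ : GL (Fin d) ℝ) : Matrix (Fin d) (Fin d) ℝ) =
      (P : Matrix (Fin d) (Fin d) ℝ).transpose := Units.inv_eq_of_mul_eq_one_right h1
  rw [h2, Matrix.mem_orthogonalGroup_iff, Matrix.transpose_transpose]
  exact (Matrix.mem_orthogonalGroup_iff' _ _).1 h

theorem mem_specialOrthogonalSubgroup {d : ℕ} (P : GL (Fin d) ℝ) :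
    P ∈ specialOrthogonalSubgroup d ↔
      P ∈ orthogonalSubgroup d ∧ (P : Matrix (Fin d) (Fin d) ℝ).det = 1 := by
  rw [specialOrthogonalSubgroup, orthogonalSubgroup, Submonoid.mem_units_iff,
    Submonoid.mem_units_iff, Matrix.mem_specialOrthogonalGroup_iff,
    Matrix.mem_specialOrthogonalGroup_iff]
  refine ⟨fun h => ⟨⟨h.1.1, h.2.1⟩, h.1.2⟩, fun h => ⟨⟨h.1.1, h.2⟩, h.1.2, ?_⟩⟩
  have h1 := congrArg Matrix.det (P.mul_inv)
  rwa [Matrix.det_mul, h.2, one_mul, Matrix.det_one] at h1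

/-- The linear automorphism `x ↦ P x` of `ℝ^d` given by an invertible matrix `P`. -/
def glEquiv {d : ℕ} (P : GL (Fin d) ℝ) : Rd d ≃L[ℝ] Rd d :=
  ContinuousLinearEquiv.equivOfInverse
    (Matrix.toEuclideanCLM (n := Fin d) (𝕜 := ℝ) (P : Matrix (Fin d) (Fin d) ℝ))
    (Matrix.toEuclideanCLM (n := Fin d) (𝕜 := ℝ)
      ((P⁻¹ : GL (Fin d) ℝ) : Matrix (Fin d) (Fin d) ℝ))
    (fun x => by rw [← mul_apply_eq_comp, ← map_mul, ← Units.val_mul]; simp)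
    (fun x => by rw [← mul_apply_eq_comp, ← map_mul, ← Units.val_mul]; simp)

theorem glEquiv_apply {d : ℕ} (P : GL (Fin d) ℝ) (x : Rd d) (i : Fin d) :
    glEquiv P x i = ∑ j, (P : Matrix (Fin d) (Fin d) ℝ) i j * x j := rfl

/-! ### The operators on continuous functions -/

/-- The translation operator `τ_h(f)(x) = f(x + h)`. -/
def contTranslate {d : ℕ} (h : Rd d) (f : ContFun d) : ContFun d :=
  ⟨fun x => f (x + h), by fun_prop⟩

/-- The operator `O_P(f)(x) = f(P x)`. -/
def contO {d : ℕ} (P : GL (Fin d) ℝ) (f : ContFun d) : ContFun d :=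
  ⟨fun x => f (glEquiv P x), by fun_prop⟩

/-! ### The operators on test functions and distributions -/

/-- Composition of test functions with a smooth homeomorphism `g` of `ℝ^d`, as a continuous linear
operator; the bound `hb` on derivatives, which yields continuity, is checked below in the two
cases of interest (translations and linear automorphisms). -/
def testComp {d : ℕ} (g : Rd d ≃ₜ Rd d) (hg : ContDiff ℝ ∞ g)
    (hb : ∀ i : ℕ, ∃ C : ℝ, 0 ≤ C ∧ ∀ φ : Rd d → ℝ, ContDiff ℝ ∞ φ → ∀ x,
      ‖iteratedFDeriv ℝ i (φ ∘ g) x‖ ≤ C * ‖iteratedFDeriv ℝ i φ (g x)‖) :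
    Test d →L[ℝ] Test d :=
  TestFunction.limitCLM ℝ
    (fun φ => ⟨φ ∘ g, φ.contDiff.comp hg, φ.hasCompactSupport.comp_homeomorph g,
      fun _ _ => trivial⟩)
    (fun K _ =>
      (TestFunction.ofSupportedInCLM ℝ (Ω := (⊤ : Opens (Rd d)))
          (K := K.map g.symm g.symm.continuous) (fun _ _ => trivial)).comp
        (ContDiffMapSupportedIn.mkCLM ℝ (fun φ => φ ∘ g) (fun _ _ _ => rfl) (fun _ _ _ => rfl)
          (fun φ => φ.contDiff.comp hg)
          (fun φ x hx => φ.zero_on_compl (fun h => hx ⟨g x, h, by simp⟩))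
          (fun i _ => by
            obtain ⟨C, hC, h⟩ := hb i
            refine ⟨{i}, C, hC, fun φ x _ => (h φ φ.contDiff x).trans ?_⟩
            rw [Finset.sup_singleton]
            exact mul_le_mul_of_nonneg_left
              (ContDiffMapSupportedIn.norm_iteratedFDeriv_apply_le_seminorm_top ℝ) hC)))
    (fun _ _ _ => rfl)

/-- The translation operator `τ_h(φ)(x) = φ(x + h)` on test functions. -/
def testTranslate {d : ℕ} (h : Rd d) : Test d →L[ℝ] Test d :=
  testComp (Homeomorph.addRight h) (contDiff_id.add contDiff_const) (fun i =>
    ⟨1, zero_le_one, fun φ _ x => by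
      have := iteratedFDeriv_comp_add_right (𝕜 := ℝ) (f := φ) i h x
      rw [one_mul]
      exact (congrArg norm this).le⟩)

theorem testTranslate_apply {d : ℕ} (h : Rd d) (φ : Test d) (x : Rd d) :
    testTranslate h φ x = φ (x + h) := rfl

/-- The operator `O_P(φ)(x) = φ(P x)` on test functions. -/
def testO {d : ℕ} (P : GL (Fin d) ℝ) : Test d →L[ℝ] Test d :=
  testComp (glEquiv P).toHomeomorph (glEquiv P).contDiff (fun i =>
    ⟨‖(glEquiv P : Rd d →L[ℝ] Rd d)‖ ^ i, by positivity, fun φ hφ x => by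
      have := (glEquiv P : Rd d →L[ℝ] Rd d).iteratedFDeriv_comp_right (f := φ) hφ x
        (i := i) (by exact_mod_cast le_top)
      refine (congrArg norm this).le.trans ?_
      refine (ContinuousMultilinearMap.norm_compContinuousLinearMap_le _ _).trans ?_
      simp [mul_comm]⟩)

theorem testO_apply {d : ℕ} (P : GL (Fin d) ℝ) (φ : Test d) (x : Rd d) :
    testO P φ x = φ (glEquiv P x) := rfl

/-- The translation operator on distributions: `τ_h(f){φ} = f{τ_{-h} φ}`. -/
def distTranslate {d : ℕ} (h : Rd d) (f : Distr d) : Distr d :=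
  (testTranslate (-h)).precompCompactConvergenceCLM ℝ f

theorem distTranslate_apply {d : ℕ} (h : Rd d) (f : Distr d) (φ : Test d) :
    distTranslate h f φ = f (testTranslate (-h) φ) := rfl

/-- The operator `O_P` on distributions: `O_P(f){φ} = |det P|⁻¹ f{O_{P⁻¹} φ}`. -/
def distO {d : ℕ} (P : GL (Fin d) ℝ) (f : Distr d) : Distr d :=
  |(P : Matrix (Fin d) (Fin d) ℝ).det|⁻¹ • (testO P⁻¹).precompCompactConvergenceCLM ℝ f

theorem distO_apply {d : ℕ} (P : GL (Fin d) ℝ) (f : Distr d) (φ : Test d) :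
    distO P f φ = |(P : Matrix (Fin d) (Fin d) ℝ).det|⁻¹ * f (testO P⁻¹ φ) := rfl

/-! ### Ordinary polynomials -/

/-- The continuous function `f` is an ordinary polynomial in `d` real variables. -/
def ContIsPolynomial {d : ℕ} (f : ContFun d) : Prop :=
  ∃ p : MvPolynomial (Fin d) ℝ, ∀ x : Rd d, f x = MvPolynomial.eval (fun i => x i) p

/-- The distribution `f` is an ordinary polynomial (in distributional sense): it is the regular
distribution `φ ↦ ∫ p φ` of an ordinary polynomial `p` in `d` real variables. -/
def DistIsPolynomial {d : ℕ} (f : Distr d) : Prop :=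
  ∃ p : MvPolynomial (Fin d) ℝ, ∀ φ : Test d,
    f φ = ∫ x : Rd d, MvPolynomial.eval (fun i => x i) p * φ x

end InvariantPoly

end

open MeasureTheory TopologicalSpace
open scoped Distributions ContDiff CompactConvergenceCLM BoundedContinuousFunction

noncomputable section

namespace InvariantPoly

/-! ### Continuous one-parameter semigroups in Banach algebras -/

/-! On a finite-dimensional invariant space `V` the translations form a continuous representation
`T` of `ℝ^d`, so along each coordinate axis `T` is `t ↦ exp (t • a i)`, and the `a i` commute.
Conjugation by rotations in the plane of axes `i`, `j` makes `a i` similar to `cos θ • a i + sin θ •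
a j` for every `θ`. After complexification, a common eigenvector of `a i`, `a j` with eigenvalues
`μ`, `ν` puts `cos θ * μ + sin θ * ν` into the finite spectrum of `a i` for all `θ`. By
connectedness this value is constant; `θ = 0` and `θ = π` give `μ = -μ`, so `μ = 0`. Hence each `a
i` is nilpotent, its exponential series terminates, and all matrix coefficients of `T` are
polynomials (`polynomial_and_average_of_representation`).

For continuous functions, `f x` is the coefficient of `T x f` against evaluation at `0`.
Distributions have no point values, so `f` is first written as an average `∫ ψ(h) τ_h w dh`. By
`dist_testConv` and commutativity of convolution, `f φ = w (ψ * φ) = w (φ * ψ) = ∫ φ(h) (τ_h w)(ψ)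
dh`, whose density `h ↦ (τ_h w)(ψ)` is a matrix coefficient, hence a polynomial. -/

open Filter Topology in
-- Integration upgrades continuity to differentiability: the primitive `F` satisfies `T t * F δ = F
-- (t + δ) - F t`, and `F δ` is a unit for some `δ` because `F t / t → 1` and units are open. Then
-- `T' = T * T'(0)`, and the generator is `T'(0)`.
theorem exists_eq_exp_of_continuous {A : Type*} [NormedRing A] [NormedAlgebra ℝ A]
    [CompleteSpace A] {T : ℝ → A} (hT : Continuous T) (h0 : T 0 = 1)
    (hadd : ∀ s t, T (s + t) = T s * T t) : ∃ a : A, ∀ t, T t = NormedSpace.exp (t • a) := by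
  set F : ℝ → A := fun t => ∫ s in (0 : ℝ)..t, T s with hF
  have hFd : ∀ t, HasDerivAt F (T t) t := fun t =>
    intervalIntegral.integral_hasDerivAt_right (hT.intervalIntegrable _ _)
      (hT.stronglyMeasurableAtFilter _ _) hT.continuousAt
  have hunit : ∃ δ : ℝ, IsUnit (F δ) := by
    have h1 := (hFd 0).tendsto_slope_zero
    rw [h0] at h1
    have h2 : ∀ᶠ t in 𝓝[≠] (0 : ℝ), IsUnit (t⁻¹ • (F (0 + t) - F 0)) :=
      h1.eventually (Units.isOpen.mem_nhds isUnit_one)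
    obtain ⟨t, ht, ht0⟩ := (h2.and self_mem_nhdsWithin).exists
    replace ht0 : t ≠ 0 := ht0
    have hF0 : F 0 = 0 := intervalIntegral.integral_same
    rw [hF0, sub_zero, zero_add] at ht
    refine ⟨t, ?_⟩
    obtain ⟨u, hu⟩ := ht
    have : F t = ((Units.mk0 t ht0) • u : Aˣ) := by
      rw [Units.val_smul, hu, Units.smul_mk0, smul_inv_smul₀ ht0]
    rw [this]
    exact Units.isUnit _
  obtain ⟨δ, u, hu⟩ := hunit
  have hTF : ∀ t, T t * F δ = F (t + δ) - F t := by
    intro t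
    rw [hF]
    simp only
    rw [intervalIntegral.integral_interval_sub_left (hT.intervalIntegrable _ _)
      (hT.intervalIntegrable _ _)]
    have : ∫ s in t..(t + δ), T s = ∫ s in (0 : ℝ)..δ, T (t + s) := by
      rw [intervalIntegral.integral_comp_add_left (fun s => T s) t, add_zero]
    rw [this]
    simp_rw [hadd]
    exact ((ContinuousLinearMap.mul ℝ A (T t)).intervalIntegral_comp_comm
      (hT.intervalIntegrable _ _)).symm
  have hTeq : T = fun t => (F (t + δ) - F t) * (↑u⁻¹ : A) := by
    funext t
    rw [← hTF, ← hu, mul_assoc, Units.mul_inv, mul_one]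
  have hdiff : Differentiable ℝ T := by
    rw [hTeq]
    intro t
    exact (((hFd (t + δ)).comp_add_const t δ).sub (hFd t)).mul_const _ |>.differentiableAt
  have hTd : ∀ t, HasDerivAt T (T t * deriv T 0) t := by
    intro t
    have h1 : HasDerivAt (fun s => T t * T (s - t)) (T t * deriv T 0) t := by
      have h2 : HasDerivAt T (deriv T 0) (t - t) := by
        rw [sub_self]
        exact (hdiff 0).hasDerivAt
      exact (h2.comp_sub_const t t).const_mul (T t)
    convert h1 using 1
    funext s
    rw [← hadd, add_sub_cancel]
  refine ⟨deriv T 0, fun t => ?_⟩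
  set a := deriv T 0
  have hE : ∀ t : ℝ, HasDerivAt (fun s : ℝ => T s * NormedSpace.exp (s • (-a))) 0 t := by
    intro t
    have h := (hTd t).mul (hasDerivAt_exp_smul_const' (𝕂 := ℝ) (-a) t)
    refine h.congr_deriv ?_
    rw [mul_assoc, ← mul_add, ← add_mul, add_neg_cancel, zero_mul, mul_zero]
  have hconst : T t * NormedSpace.exp (t • (-a)) = 1 := by
    have := is_const_of_deriv_eq_zero (fun s => (hE s).differentiableAt)
      (fun s => (hE s).deriv) t 0
    simpa [h0] using this
  have hinv : NormedSpace.exp (t • (-a)) * NormedSpace.exp (t • a) = 1 := by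
    let _ : NormedAlgebra ℚ A := NormedAlgebra.restrictScalars ℚ ℝ A
    rw [smul_neg, ← NormedSpace.exp_add_of_commute (Commute.refl (t • a)).neg_left, neg_add_cancel,
      NormedSpace.exp_zero]
  calc T t = T t * (NormedSpace.exp (t • (-a)) * NormedSpace.exp (t • a)) := by rw [hinv, mul_one]
    _ = _ := by rw [← mul_assoc, hconst, one_mul]

theorem exp_smul_eq_sum_of_pow_eq_zero {A : Type*} [NormedRing A] [NormedAlgebra ℝ A] {a : A}
    {n : ℕ} (h : a ^ n = 0) (t : ℝ) :
    NormedSpace.exp (t • a) = ∑ k ∈ Finset.range n, t ^ k • ((k.factorial : ℝ)⁻¹ • a ^ k) := by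
  rw [NormedSpace.exp_eq_tsum ℝ]
  beta_reduce
  rw [tsum_eq_sum (s := Finset.range n)]
  · refine Finset.sum_congr rfl fun k _ => ?_
    rw [smul_pow, smul_comm]
  · intro k hk
    rw [smul_pow, pow_eq_zero_of_le (by simpa using hk) h, smul_zero, smul_zero]

/-! ### Nilpotency of generators -/

open Module Module.End Polynomial in
-- Over `ℂ` the generalized eigenspaces span, so the one for `0` is everything.
theorem isNilpotent_of_forall_hasEigenvalue_eq_zero {E : Type*} [AddCommGroup E] [Module ℂ E]
    [FiniteDimensional ℂ E] {a : End ℂ E} (h : ∀ μ, a.HasEigenvalue μ → μ = 0) :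
    IsNilpotent a := by
  have h1 : maxGenEigenspace a 0 = ⊤ := by
    rw [eq_top_iff, ← iSup_maxGenEigenspace_eq_top a]
    refine iSup_le fun μ => ?_
    by_cases hμ : a.HasEigenvalue μ
    · rw [h μ hμ]
    · have : maxGenEigenspace a μ = ⊥ := by
        by_contra hne
        exact hμ (HasUnifEigenvalue.lt (k := ⊤) zero_lt_one hne)
      rw [this]
      exact bot_le
  have h2 := (LinearMap.charpoly_nilpotent_tfae a).out 0 2
  rw [h2]
  intro m
  have hm : m ∈ maxGenEigenspace a 0 := h1 ▸ Submodule.mem_top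
  rw [mem_maxGenEigenspace] at hm
  simpa using hm

open Module Module.End in
/-- If `a` and `b` commute and all rotated combinations `cos θ • a + sin θ • b` are conjugate
to `a`, then `a` is nilpotent. -/
theorem isNilpotent_of_conj_rotation_complex {E : Type*} [AddCommGroup E] [Module ℂ E]
    [FiniteDimensional ℂ E] {a b : End ℂ E} (hab : Commute a b)
    (hconj : ∀ θ : ℝ, ∃ r : End ℂ E, IsUnit r ∧
      r * a = ((Real.cos θ : ℂ) • a + (Real.sin θ : ℂ) • b) * r) : IsNilpotent a := by
  -- Since `b` preserves the `μ`-eigenspace of `a`, it has an eigenvector `v` there; `c θ` is the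
  -- eigenvalue of the rotated combination on `v`.
  refine isNilpotent_of_forall_hasEigenvalue_eq_zero fun μ hμ => ?_
  have hmaps := mapsTo_genEigenspace_of_comm hab μ 1
  have : Nontrivial (eigenspace a μ) := Submodule.nontrivial_iff_ne_bot.2 hμ
  obtain ⟨ν, hν⟩ := exists_eigenvalue (LinearMap.restrict b hmaps)
  obtain ⟨⟨v, hva⟩, hv⟩ := hν.exists_hasEigenvector
  have hv0 : v ≠ 0 := fun h => hv.2 (Subtype.ext h)
  have hav : a v = μ • v := mem_eigenspace_iff.1 hva
  have hbv : b v = ν • v := congrArg Subtype.val hv.apply_eq_smul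
  set c : ℝ → ℂ := fun θ => Real.cos θ * μ + Real.sin θ * ν with hc
  have hmem : ∀ θ, c θ ∈ {z | a.HasEigenvalue z} := by
    intro θ
    obtain ⟨r, hr, hra⟩ := hconj θ
    obtain ⟨u, rfl⟩ := hr
    refine hasEigenvalue_of_hasEigenvector (x := (↑u⁻¹ : End ℂ E) v) ⟨?_, fun h0 => hv0 ?_⟩
    · rw [mem_eigenspace_iff]
      have h1 : a = (↑u⁻¹ : End ℂ E) * (((Real.cos θ : ℂ) • a + (Real.sin θ : ℂ) • b) * u) := by
        rw [← hra, ← mul_assoc, Units.inv_mul, one_mul]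
      have h2 : (u : End ℂ E) ((↑u⁻¹ : End ℂ E) v) = v := by
        rw [← Module.End.mul_apply, Units.mul_inv, Module.End.one_apply]
      conv_lhs => rw [h1]
      rw [Module.End.mul_apply, Module.End.mul_apply, h2, LinearMap.add_apply,
        LinearMap.smul_apply, LinearMap.smul_apply, hav, hbv, smul_smul, smul_smul, ← add_smul,
        map_smul]
    · have := congrArg (u : End ℂ E) h0
      rwa [map_zero, ← Module.End.mul_apply, Units.mul_inv, Module.End.one_apply] at this
  have hfin : {z | a.HasEigenvalue z}.Finite := finite_hasEigenvalue a
  have hcont : Continuous c := by fun_prop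
  -- A connected subset of `ℂ` with two points is infinite, whereas the spectrum is finite.
  have hrange : (Set.range c).Subsingleton := by
    rw [← Set.not_nontrivial_iff]
    exact fun hn => (isPreconnected_range hcont).infinite_of_nontrivial hn
      (hfin.subset (Set.range_subset_iff.2 hmem))
  have h0 : c 0 = c Real.pi := hrange ⟨0, rfl⟩ ⟨Real.pi, rfl⟩
  simp only [hc, Real.cos_zero, Real.sin_zero, Real.cos_pi, Real.sin_pi, Complex.ofReal_one,
    Complex.ofReal_zero, Complex.ofReal_neg, zero_mul, add_zero, one_mul, neg_mul] at h0
  exact CharZero.eq_neg_self_iff.1 h0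

open Module Module.End in
theorem isNilpotent_of_conj_rotation {E : Type*} [AddCommGroup E] [Module ℝ E]
    [FiniteDimensional ℝ E] {a b : End ℝ E} (hab : Commute a b)
    (hconj : ∀ θ : ℝ, ∃ r : End ℝ E, IsUnit r ∧
      r * a = (Real.cos θ • a + Real.sin θ • b) * r) : IsNilpotent a := by
  have hmul : ∀ x y : End ℝ E, (x * y).baseChange ℂ = x.baseChange ℂ * y.baseChange ℂ :=
    fun x y => LinearMap.baseChange_comp _ _
  have hinj : Function.Injective (fun x : End ℝ E => x.baseChange ℂ) :=
    LinearMap.baseChangeHom_injective ℝ E ℂ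
  have h : IsNilpotent (a.baseChange ℂ) := by
    refine isNilpotent_of_conj_rotation_complex (b := b.baseChange ℂ) ?_ fun θ => ?_
    · rw [commute_iff_eq, ← hmul, ← hmul, hab.eq]
    · obtain ⟨r, hr, hra⟩ := hconj θ
      refine ⟨r.baseChange ℂ, hr.map (Module.End.baseChangeHom ℝ ℂ E), ?_⟩
      rw [← hmul, hra, hmul, LinearMap.baseChange_add, LinearMap.baseChange_smul,
        LinearMap.baseChange_smul]
      rfl
  obtain ⟨n, hn⟩ := h
  refine ⟨n, hinj ?_⟩
  simp only [LinearMap.baseChange_zero]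
  rw [← hn]
  exact map_pow (Module.End.baseChangeHom ℝ ℂ E) a n

/-! ### Plane rotations -/

/-- The rotation by the angle `θ` in the plane spanned by the `i`-th and `j`-th coordinates. -/
def planeRotationMatrix {d : ℕ} (i j : Fin d) (θ : ℝ) : Matrix (Fin d) (Fin d) ℝ :=
  1 + (Real.cos θ - 1) • (Matrix.single i i 1 + Matrix.single j j 1) +
    Real.sin θ • (Matrix.single j i 1 - Matrix.single i j 1)

theorem planeRotationMatrix_zero {d : ℕ} (i j : Fin d) : planeRotationMatrix i j 0 = 1 := by
  simp [planeRotationMatrix]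

theorem planeRotationMatrix_mul {d : ℕ} {i j : Fin d} (hij : i ≠ j) (α β : ℝ) :
    planeRotationMatrix i j α * planeRotationMatrix i j β = planeRotationMatrix i j (α + β) := by
  simp only [planeRotationMatrix, Real.cos_add, Real.sin_add]
  -- `U` is the projection onto the plane and `J` the quarter turn in it, so they multiply like `1`
  -- and `√-1`.
  set U : Matrix (Fin d) (Fin d) ℝ := Matrix.single i i 1 + Matrix.single j j 1 with hU
  set J : Matrix (Fin d) (Fin d) ℝ := Matrix.single j i 1 - Matrix.single i j 1 with hJ
  have hUU : U * U = U := by simp [hU, add_mul, mul_add, hij, hij.symm]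
  have hUJ : U * J = J := by simp [hU, hJ, add_mul, mul_sub, hij, hij.symm]
  have hJU : J * U = J := by simp [hU, hJ, sub_mul, mul_add, hij, hij.symm, ← sub_eq_add_neg]
  have hJJ : J * J = -U := by simp [hU, hJ, sub_mul, mul_sub, hij, hij.symm]; abel
  simp only [add_mul, mul_add, one_mul, mul_one, smul_mul_assoc, mul_smul_comm, hUU, hUJ, hJU, hJJ]
  module

theorem transpose_planeRotationMatrix {d : ℕ} (i j : Fin d) (θ : ℝ) :
    (planeRotationMatrix i j θ).transpose = planeRotationMatrix i j (-θ) := by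
  simp only [planeRotationMatrix, Matrix.transpose_add, Matrix.transpose_sub,
    Matrix.transpose_smul, Matrix.transpose_single, Matrix.transpose_one, Real.cos_neg,
    Real.sin_neg]
  module

theorem planeRotationMatrix_mul_transpose {d : ℕ} {i j : Fin d} (hij : i ≠ j) (θ : ℝ) :
    planeRotationMatrix i j θ * (planeRotationMatrix i j θ).transpose = 1 := by
  rw [transpose_planeRotationMatrix, planeRotationMatrix_mul hij, add_neg_cancel,
    planeRotationMatrix_zero]

theorem det_planeRotationMatrix {d : ℕ} {i j : Fin d} (hij : i ≠ j) (θ : ℝ) :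
    (planeRotationMatrix i j θ).det = 1 := by
  -- Orthogonality only gives `det = ±1`; being the square of the half-angle rotation fixes the
  -- sign.
  have h := congrArg Matrix.det (planeRotationMatrix_mul_transpose hij (θ / 2))
  rw [Matrix.det_mul, Matrix.det_transpose, Matrix.det_one] at h
  rw [← add_halves θ, ← planeRotationMatrix_mul hij, Matrix.det_mul, h]

/-- The rotation by the angle `θ` in the plane spanned by the `i`-th and `j`-th coordinates, as
an element of `GL(d, ℝ)`. -/
def planeRotation {d : ℕ} {i j : Fin d} (hij : i ≠ j) (θ : ℝ) : GL (Fin d) ℝ where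
  val := planeRotationMatrix i j θ
  inv := planeRotationMatrix i j (-θ)
  val_inv := by rw [planeRotationMatrix_mul hij, add_neg_cancel, planeRotationMatrix_zero]
  inv_val := by rw [planeRotationMatrix_mul hij, neg_add_cancel, planeRotationMatrix_zero]

theorem planeRotation_mem {d : ℕ} {i j : Fin d} (hij : i ≠ j) (θ : ℝ) :
    planeRotation hij θ ∈ specialOrthogonalSubgroup d := by
  rw [mem_specialOrthogonalSubgroup, mem_orthogonalSubgroup]
  exact ⟨planeRotationMatrix_mul_transpose hij θ, det_planeRotationMatrix hij θ⟩

theorem glEquiv_planeRotation_single {d : ℕ} {i j : Fin d} (hij : i ≠ j) (θ t : ℝ) :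
    glEquiv (planeRotation hij θ) (EuclideanSpace.single i t) =
      EuclideanSpace.single i (t * Real.cos θ) + EuclideanSpace.single j (t * Real.sin θ) := by
  ext k
  rw [glEquiv_apply]
  change ∑ l, planeRotationMatrix i j θ k l * _ = _
  simp only [PiLp.single_apply, mul_ite, mul_zero, Finset.sum_ite_eq',
    Finset.mem_univ, if_true, PiLp.add_apply, planeRotationMatrix, Matrix.add_apply,
    Matrix.smul_apply, Matrix.sub_apply, Matrix.single_apply, Matrix.one_apply]
  rcases eq_or_ne k i with rfl | hki
  · simp [hij, hij.symm]; ring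
  · rcases eq_or_ne k j with rfl | hkj
    · simp [hij, hij.symm]; ring
    · simp [hki, hkj, hki.symm, hkj.symm]

/-! ### Finite-dimensional representations of the group of rigid motions -/

/-- The `A`-valued polynomial functions on `ℝ^d`. -/
def polySpan (d : ℕ) (A : Type*) [Ring A] [Algebra ℝ A] : Submodule ℝ (Rd d → A) :=
  Submodule.span ℝ {F | ∃ (p : MvPolynomial (Fin d) ℝ) (a : A),
    F = fun x => MvPolynomial.eval (fun i => x i) p • a}

theorem mul_mem_polySpan {d : ℕ} {A : Type*} [Ring A] [Algebra ℝ A] {F H : Rd d → A}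
    (hF : F ∈ polySpan d A) (hH : H ∈ polySpan d A) : F * H ∈ polySpan d A := by
  have h := Submodule.mul_mem_mul hF hH
  rw [polySpan, Submodule.span_mul_span] at h
  refine Submodule.span_mono ?_ h
  rintro _ ⟨_, ⟨p, a, rfl⟩, _, ⟨q, b, rfl⟩, rfl⟩
  refine ⟨p * q, a * b, ?_⟩
  funext x
  simp only [Pi.mul_apply, map_mul, smul_mul_smul_comm]

theorem exists_eval_eq_of_mem_polySpan {d : ℕ} {A : Type*} [Ring A] [Algebra ℝ A] {F : Rd d → A}
    (hF : F ∈ polySpan d A) (ℓ : A →ₗ[ℝ] ℝ) :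
    ∃ p : MvPolynomial (Fin d) ℝ, ∀ x, ℓ (F x) = MvPolynomial.eval (fun i => x i) p := by
  refine Submodule.span_induction ?_ ?_ ?_ ?_ hF
  · rintro _ ⟨p, a, rfl⟩
    exact ⟨p * MvPolynomial.C (ℓ a), fun x => by simp⟩
  · exact ⟨0, fun x => by simp⟩
  · rintro _ _ _ _ ⟨p, hp⟩ ⟨q, hq⟩
    exact ⟨p + q, fun x => by simp [hp, hq]⟩
  · rintro c _ _ ⟨p, hp⟩
    exact ⟨c • p, fun x => by simp [hp, MvPolynomial.smul_eval]⟩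

theorem exp_coord_mem_polySpan {d : ℕ} {A : Type*} [NormedRing A] [NormedAlgebra ℝ A] {a : A}
    (ha : IsNilpotent a) (i : Fin d) :
    (fun x : Rd d => NormedSpace.exp (x i • a)) ∈ polySpan d A := by
  obtain ⟨n, hn⟩ := ha
  have : (fun x : Rd d => NormedSpace.exp (x i • a)) = ∑ k ∈ Finset.range n,
      fun x : Rd d => MvPolynomial.eval (fun i => x i) (MvPolynomial.X i ^ k) •
        ((k.factorial : ℝ)⁻¹ • a ^ k) := by
    funext x
    simp [exp_smul_eq_sum_of_pow_eq_zero hn, Finset.sum_apply]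
  rw [this]
  exact Submodule.sum_mem _ fun k _ => Submodule.subset_span ⟨_, _, rfl⟩

open Filter Topology in
theorem mem_polySpan_of_rotation_conj {V : Type*} [NormedAddCommGroup V] [NormedSpace ℝ V]
    [FiniteDimensional ℝ V] {d : ℕ} (hd : 2 ≤ d) {T : Rd d → V →L[ℝ] V}
    (hT : Continuous T) (h0 : T 0 = 1) (hadd : ∀ x y, T (x + y) = T x * T y)
    (hconj : ∀ P ∈ specialOrthogonalSubgroup d, ∃ r : V →ₗ[ℝ] V, IsUnit r ∧
      ∀ x, r * (T x : V →ₗ[ℝ] V) = (T (glEquiv P x) : V →ₗ[ℝ] V) * r) :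
    T ∈ polySpan d (V →L[ℝ] V) := by
  have : CompleteSpace (V →L[ℝ] V) := FiniteDimensional.complete ℝ _
  have hexp : ∀ i : Fin d, ∃ a : V →L[ℝ] V, ∀ t : ℝ,
      T (EuclideanSpace.single i t) = NormedSpace.exp (t • a) := by
    intro i
    refine exists_eq_exp_of_continuous (T := fun t => T (EuclideanSpace.single i t)) ?_ ?_ ?_
    · refine hT.comp ?_
      exact (LinearMap.continuous_of_finiteDimensional
        ((WithLp.linearEquiv 2 ℝ (Fin d → ℝ)).symm.toLinearMap ∘ₗ LinearMap.single ℝ _ i) :)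
    · rw [← h0]
      congr 1
      ext k
      simp
    · intro s t
      rw [← hadd]
      congr 1
      ext k
      simp
      split_ifs <;> simp
  choose a ha using hexp
  have hderiv : ∀ i, HasDerivAt (fun t : ℝ => T (EuclideanSpace.single i t)) (a i) 0 := by
    intro i
    simp_rw [ha]
    simpa using hasDerivAt_exp_smul_const (𝕂 := ℝ) (a i) 0
  have hcommT : ∀ x y, Commute (T x) (T y) := fun x y => by
    rw [commute_iff_eq, ← hadd, ← hadd, add_comm]
  -- The relation `T x * T y = T y * T x` is differentiated in one variable, then in the other.
  have hcomm : ∀ i j, Commute (a i) (a j) := by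
    intro i j
    have h1 : ∀ t : ℝ, Commute (T (EuclideanSpace.single j t)) (a i) := by
      intro t
      have hl := (hderiv i).const_mul (T (EuclideanSpace.single j t))
      have hr := (hderiv i).mul_const (T (EuclideanSpace.single j t))
      refine hl.unique (hr.congr_of_eventuallyEq (Eventually.of_forall fun s => ?_))
      exact hcommT _ _
    have hl := (hderiv j).const_mul (a i)
    have hr := (hderiv j).mul_const (a i)
    exact hl.unique (hr.congr_of_eventuallyEq (Eventually.of_forall fun s => (h1 s).symm.eq))
  have hnil : ∀ i, IsNilpotent (a i) := by
    intro i
    obtain ⟨j, hij⟩ : ∃ j : Fin d, i ≠ j := by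
      have : Nontrivial (Fin d) := Fin.nontrivial_iff_two_le.2 hd
      obtain ⟨j, hj⟩ := exists_ne i
      exact ⟨j, hj.symm⟩
    have hlin : IsNilpotent ((a i : V →L[ℝ] V) : V →ₗ[ℝ] V) := by
      refine isNilpotent_of_conj_rotation (b := (a j : V →ₗ[ℝ] V)) ?_ fun θ => ?_
      · exact (hcomm i j).map (ContinuousLinearMap.toLinearMapRingHom)
      obtain ⟨r, hr, hrT⟩ := hconj _ (planeRotation_mem hij θ)
      refine ⟨r, hr, ?_⟩
      have hcos : HasDerivAt (fun t : ℝ => T (EuclideanSpace.single i (t * Real.cos θ)))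
          (Real.cos θ • a i) 0 := by
        have := HasDerivAt.scomp (h := fun t : ℝ => t * Real.cos θ) (0 : ℝ)
          (by simpa using hderiv i) ((hasDerivAt_id (0 : ℝ)).mul_const (Real.cos θ))
        rwa [one_mul] at this
      have hsin : HasDerivAt (fun t : ℝ => T (EuclideanSpace.single j (t * Real.sin θ)))
          (Real.sin θ • a j) 0 := by
        have := HasDerivAt.scomp (h := fun t : ℝ => t * Real.sin θ) (0 : ℝ)
          (by simpa using hderiv j) ((hasDerivAt_id (0 : ℝ)).mul_const (Real.sin θ))
        rwa [one_mul] at this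
      have hrhs := hcos.mul hsin
      have hz : ∀ k : Fin d, (EuclideanSpace.single k (0 : ℝ) : Rd d) = 0 := fun k => by
        ext l; simp
      simp only [zero_mul, hz, h0, mul_one, one_mul] at hrhs
      set R : V →L[ℝ] V := LinearMap.toContinuousLinearMap r with hR
      have hL := (hderiv i).const_mul R
      have hRr := hrhs.mul_const R
      -- Derivative at `t = 0` of the conjugation relation along `t ↦ t e_i`.
      have heq : R * a i = (Real.cos θ • a i + Real.sin θ • a j) * R := by
        refine hL.unique (hRr.congr_of_eventuallyEq (Eventually.of_forall fun t => ?_))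
        have h1 := hrT (EuclideanSpace.single i t)
        rw [glEquiv_planeRotation_single, hadd] at h1
        ext v
        exact LinearMap.congr_fun h1 v
      ext v
      exact DFunLike.congr_fun heq v
    obtain ⟨n, hn⟩ := hlin
    refine ⟨n, ?_⟩
    ext v
    rw [← ContinuousLinearMap.coe_coe, ContinuousLinearMap.toLinearMap_pow, hn]
    rfl
  have hprod : ∀ s : Finset (Fin d),
      (fun x : Rd d => T (∑ i ∈ s, EuclideanSpace.single i (x i))) ∈ polySpan d (V →L[ℝ] V) := by
    intro s
    induction s using Finset.induction_on with
    | empty =>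
      simp only [Finset.sum_empty, h0]
      exact Submodule.subset_span ⟨1, 1, by simp⟩
    | insert i s hi ih =>
      simp only [Finset.sum_insert hi, hadd, ha]
      exact mul_mem_polySpan (exp_coord_mem_polySpan (hnil i) i) ih
  convert hprod Finset.univ with x
  ext k
  simp

/-- Averaging against a suitable test function is onto. -/
theorem exists_test_integral_smul_isUnit {d : ℕ} {A : Type*} [NormedRing A] [NormedAlgebra ℝ A]
    [CompleteSpace A] {T : Rd d → A} (hT : Continuous T) (h0 : T 0 = 1) :
    ∃ ψ : Test d, IsUnit (∫ x, ψ x • T x) := by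
  have hc : ∀ᶠ x in nhds (0 : Rd d), dist (T (-x)) (T (-0)) < 1 / 2 := by
    have : Continuous fun x => T (-x) := hT.comp continuous_neg
    exact this.continuousAt.eventually (Metric.ball_mem_nhds _ (by norm_num))
  obtain ⟨ε, hε, hball⟩ := Metric.eventually_nhds_iff_ball.1 hc
  let b : ContDiffBump (0 : Rd d) := ⟨ε / 2, ε, by linarith, by linarith⟩
  refine ⟨⟨b.normed volume, b.contDiff_normed, b.hasCompactSupport_normed, fun _ _ => trivial⟩, ?_⟩
  -- The reflection makes the convolution at `0` equal to `∫ ψ x • T x`. It lies within `1 / 2` of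
  -- `1`, hence is a unit.
  have h := b.dist_normed_convolution_le (μ := volume) (g := fun x => T (-x)) (x₀ := 0) (ε := 1 / 2)
    (hT.comp continuous_neg).aestronglyMeasurable (fun x hx => (hball x hx).le)
  simp only [convolution, ContinuousLinearMap.lsmul_apply, zero_sub, neg_neg, neg_zero, h0] at h
  rw [dist_comm, dist_eq_norm] at h
  have := isUnit_one_sub_of_norm_lt_one (h.trans_lt (by norm_num))
  rwa [sub_sub_cancel] at this

open Module in
-- In finite dimension a separating set of functionals spans the dual.
theorem continuous_dual_of_separating {X V : Type*} [TopologicalSpace X] [AddCommGroup V]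
    [Module ℝ V] [FiniteDimensional ℝ V] {F : X → V} {S : Set (Dual ℝ V)}
    (hS : ∀ v, (∀ ℓ ∈ S, ℓ v = 0) → v = 0) (hF : ∀ ℓ ∈ S, Continuous fun x => ℓ (F x))
    (ℓ : Dual ℝ V) : Continuous fun x => ℓ (F x) := by
  have htop : Submodule.span ℝ S = ⊤ := by
    have h : (Submodule.span ℝ S).dualCoannihilator = ⊥ := by
      rw [eq_bot_iff]
      intro v hv
      rw [Submodule.mem_dualCoannihilator] at hv
      exact hS v fun ℓ hℓ => hv ℓ (Submodule.subset_span hℓ)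
    rw [← Subspace.dualCoannihilator_dualAnnihilator_eq (W := Submodule.span ℝ S), h,
      Submodule.dualAnnihilator_bot]
  have hℓ : ℓ ∈ Submodule.span ℝ S := htop ▸ Submodule.mem_top
  refine Submodule.span_induction (fun ℓ h => hF ℓ h) ?_ ?_ ?_ hℓ
  · simpa using continuous_const
  · intro a b _ _ ha hb
    exact ha.add hb
  · intro c a _ ha
    exact ha.const_smul c

theorem continuous_toContinuousLinearMap_of_dual {X V : Type*} [TopologicalSpace X]
    [NormedAddCommGroup V] [NormedSpace ℝ V] [FiniteDimensional ℝ V] {T : X → V →ₗ[ℝ] V}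
    (hT : ∀ (ℓ : Module.Dual ℝ V) v, Continuous fun x => ℓ (T x v)) :
    Continuous fun x => LinearMap.toContinuousLinearMap (T x) := by
  rw [continuous_clm_apply]
  intro v
  let b := Module.finBasis ℝ V
  have : (fun x => LinearMap.toContinuousLinearMap (T x) v) =
      fun x => ∑ i, b.coord i (T x v) • b i := by
    funext x
    exact (b.sum_repr (T x v)).symm
  rw [this]
  exact continuous_finsetSum _ fun i _ => (hT (b.coord i) v).smul continuous_const

/-- A finite-dimensional weakly continuous representation of the translation group which is
compatible with rotations has polynomial matrix coefficients, and every vector is an average of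
translates of a vector against a test function. -/
theorem polynomial_and_average_of_representation {V : Type*} [AddCommGroup V] [Module ℝ V]
    [FiniteDimensional ℝ V] {d : ℕ} (hd : 2 ≤ d) {T : Rd d → V →ₗ[ℝ] V}
    {S : Set (Module.Dual ℝ V)} (hS : ∀ v, (∀ ℓ ∈ S, ℓ v = 0) → v = 0)
    (hT : ∀ ℓ ∈ S, ∀ v, Continuous fun x => ℓ (T x v))
    (h0 : T 0 = 1) (hadd : ∀ x y, T (x + y) = T x * T y)
    (hconj : ∀ P ∈ specialOrthogonalSubgroup d, ∃ r : V →ₗ[ℝ] V, IsUnit r ∧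
      ∀ x, r * T x = T (glEquiv P x) * r) :
    (∀ (ℓ : Module.Dual ℝ V) v, ∃ p : MvPolynomial (Fin d) ℝ, ∀ x,
      ℓ (T x v) = MvPolynomial.eval (fun i => x i) p) ∧
    ∀ v, ∃ (ψ : Test d) (w : V), ∀ ℓ : Module.Dual ℝ V, ℓ v = ∫ x, ψ x * ℓ (T x w) := by
  -- Any norm will do; this one is pulled back from coordinates.
  let e := (Module.finBasis ℝ V).equivFun
  let _ : NormedAddCommGroup V := NormedAddCommGroup.induced V _ e e.injective
  let _ : NormedSpace ℝ V := NormedSpace.induced ℝ V _ e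
  set T' : Rd d → V →L[ℝ] V := fun x => LinearMap.toContinuousLinearMap (T x) with hT'
  have hcont : Continuous T' := continuous_toContinuousLinearMap_of_dual fun ℓ v =>
    continuous_dual_of_separating hS (fun ℓ hℓ => hT ℓ hℓ v) ℓ
  have h0' : T' 0 = 1 := by ext v; exact LinearMap.congr_fun h0 v
  have hadd' : ∀ x y, T' (x + y) = T' x * T' y := fun x y => by
    ext v; exact LinearMap.congr_fun (hadd x y) v
  have hpoly : T' ∈ polySpan d (V →L[ℝ] V) := by
    refine mem_polySpan_of_rotation_conj hd hcont h0' hadd' fun P hP => ?_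
    obtain ⟨r, hr, h⟩ := hconj P hP
    exact ⟨r, hr, fun x => h x⟩
  refine ⟨fun ℓ v => ?_, fun v => ?_⟩
  · exact exists_eval_eq_of_mem_polySpan hpoly
      (ℓ ∘ₗ LinearMap.applyₗ v ∘ₗ ContinuousLinearMap.coeLM ℝ)
  · have : CompleteSpace (V →L[ℝ] V) := FiniteDimensional.complete ℝ _
    have : CompleteSpace V := FiniteDimensional.complete ℝ _
    obtain ⟨ψ, u, hu⟩ := exists_test_integral_smul_isUnit hcont h0'
    refine ⟨ψ, (↑u⁻¹ : V →L[ℝ] V) v, fun ℓ => ?_⟩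
    have hint : Integrable fun x => ψ x • T' x :=
      (ψ.continuous.smul hcont).integrable_of_hasCompactSupport ψ.hasCompactSupport.smul_right
    let L : (V →L[ℝ] V) →L[ℝ] ℝ := LinearMap.toContinuousLinearMap ℓ ∘L
      ContinuousLinearMap.apply ℝ V ((↑u⁻¹ : V →L[ℝ] V) v)
    have h1 := L.integral_comp_comm hint
    rw [← hu] at h1
    have h2 : L (u : V →L[ℝ] V) = ℓ v := by
      change ℓ (((u : V →L[ℝ] V) * (↑u⁻¹ : V →L[ℝ] V)) v) = ℓ v
      rw [Units.mul_inv]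
      rfl
    rw [← h2, ← h1]
    refine integral_congr_ae (Filter.Eventually.of_forall fun x => ?_)
    simp only [map_smul, smul_eq_mul]
    rfl

/-! ### Continuous functions -/

theorem contIsPolynomial_of_invariant {d : ℕ} (hd : 2 ≤ d) {V : Submodule ℝ (ContFun d)}
    [FiniteDimensional ℝ V] (hV : ∀ h, ∀ f ∈ V, contTranslate h f ∈ V)
    (hO : ∀ P ∈ specialOrthogonalSubgroup d, ∀ f ∈ V, contO P f ∈ V) {f : ContFun d}
    (hf : f ∈ V) : ContIsPolynomial f := by
  let T : Rd d → V →ₗ[ℝ] V := fun h => LinearMap.restrict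
    { toFun := contTranslate h, map_add' := fun _ _ => rfl, map_smul' := fun _ _ => rfl } (hV h)
  let ev : Rd d → Module.Dual ℝ V := fun x =>
    { toFun := fun f => f.1 x, map_add' := fun _ _ => rfl, map_smul' := fun _ _ => rfl }
  let R : ∀ P ∈ specialOrthogonalSubgroup d, V →ₗ[ℝ] V := fun P hP => LinearMap.restrict
    { toFun := contO P, map_add' := fun _ _ => rfl, map_smul' := fun _ _ => rfl } (hO P hP)
  have hR : ∀ P hP hP', R P hP * R P⁻¹ hP' = 1 := fun P hP hP' => by
    ext f x
    change f.1 (glEquiv P⁻¹ (glEquiv P x)) = f.1 x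
    exact congrArg f.1 ((glEquiv P).symm_apply_apply x)
  have key := polynomial_and_average_of_representation hd (T := T) (S := Set.range ev)
    ?_ ?_ ?_ ?_ ?_
  · obtain ⟨p, hp⟩ := key.1 (ev 0) ⟨f, hf⟩
    refine ⟨p, fun x => ?_⟩
    rw [← hp x]
    change f x = f (0 + x)
    rw [zero_add]
  · intro v hv
    ext x
    exact hv (ev x) ⟨x, rfl⟩
  · rintro _ ⟨x, rfl⟩ v
    change Continuous fun h => v.1 (x + h)
    fun_prop
  · ext f x
    change f.1 (x + 0) = f.1 x
    rw [add_zero]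
  · intro h k
    ext f x
    change f.1 (x + (h + k)) = f.1 ((x + h) + k)
    rw [add_assoc]
  · intro P hP
    have hP' := inv_mem hP
    -- The inverse is forced by `O_{P⁻¹} τ_h = τ_{Ph} O_{P⁻¹}`.
    refine ⟨R P⁻¹ hP', ?_, fun h => ?_⟩
    · refine ⟨⟨R P⁻¹ hP', R P hP, ?_, hR P hP hP'⟩, rfl⟩
      have := hR P⁻¹ hP' (by rwa [inv_inv])
      simpa only [inv_inv] using this
    · ext f x
      change f.1 (glEquiv P⁻¹ x + h) = f.1 (glEquiv P⁻¹ (x + glEquiv P h))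
      rw [map_add (glEquiv P⁻¹)]
      exact congrArg (fun y => f.1 (glEquiv P⁻¹ x + y)) ((glEquiv P).symm_apply_apply h).symm

/-! ### Continuity of translations on test functions -/

section BoundedTranslate

variable {E F : Type*} [NormedAddCommGroup E] [NormedAddCommGroup F]

/-- The translate `x ↦ G (x + h)` of a continuous compactly supported function, as a bounded
continuous function. -/
def boundedTranslate {G : E → F} (hG : Continuous G) (hc : HasCompactSupport G) (h : E) : E →ᵇ F :=
  BoundedContinuousFunction.ofNormedAddCommGroup (fun x => G (x + h)) (by fun_prop)
    (hG.bounded_above_of_compact_support hc).choose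
    fun x => (hG.bounded_above_of_compact_support hc).choose_spec (x + h)

theorem boundedTranslate_apply {G : E → F} (hG : Continuous G) (hc : HasCompactSupport G)
    (h x : E) : boundedTranslate hG hc h x = G (x + h) := rfl

theorem continuous_boundedTranslate {G : E → F} (hG : Continuous G) (hc : HasCompactSupport G) :
    Continuous (boundedTranslate hG hc) := by
  rw [Metric.continuous_iff]
  intro h ε hε
  obtain ⟨δ, hδ, H⟩ := Metric.uniformContinuous_iff.1 (hc.uniformContinuous_of_continuous hG)
    (ε / 2) (half_pos hε)
  refine ⟨δ, hδ, fun k hk => ?_⟩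
  refine lt_of_le_of_lt ((BoundedContinuousFunction.dist_le (half_pos hε).le).2 fun x => ?_)
    (half_lt_self hε)
  refine (H ?_).le
  rwa [dist_add_left]

end BoundedTranslate

open ContDiffMapSupportedIn in
theorem continuous_testTranslate {d : ℕ} (φ : Test d) :
    Continuous fun h : Rd d => testTranslate h φ := by
  rw [continuous_iff_continuousAt]
  intro h₀
  let B := Metric.closedBall h₀ 1
  -- One compact set supports every translate with `h ∈ B`, so continuity near `h₀` can be tested in
  -- `𝓓_K`, derivative by derivative in sup norm.
  have hK : IsCompact ((fun p : Rd d × Rd d => p.1 - p.2) '' (tsupport φ ×ˢ B)) :=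
    (φ.hasCompactSupport.isCompact.prod (isCompact_closedBall h₀ 1)).image (by fun_prop)
  let K : Compacts (Rd d) := ⟨_, hK⟩
  let Φ : B → 𝓓_{K}(Rd d, ℝ) := fun h => .of_support_subset (testTranslate h.1 φ).contDiff
    fun x hx => ⟨(x + h.1, h.1), ⟨subset_tsupport _ hx, h.2⟩, add_sub_cancel_right _ _⟩
  have hΦ : Continuous Φ := by
    rw [continuous_iff_comp]
    intro i
    have hG : Continuous (iteratedFDeriv ℝ i φ) :=
      φ.contDiff.continuous_iteratedFDeriv (by exact_mod_cast le_top)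
    have hc := φ.hasCompactSupport.iteratedFDeriv (𝕜 := ℝ) i
    have : structureMapCLM ℝ ⊤ i ∘ Φ = fun h : B => boundedTranslate hG hc h.1 := by
      funext h
      ext1 x
      rw [Function.comp_apply, structureMapCLM_top_apply, boundedTranslate_apply]
      exact iteratedFDeriv_comp_add_right i h.1 x
    rw [this]
    exact (continuous_boundedTranslate hG hc).comp continuous_subtype_val
  have hcomp : Continuous fun h : B => testTranslate h.1 φ :=
    (TestFunction.continuous_ofSupportedIn (Ω := (⊤ : Opens (Rd d))) (K := K)
      (fun _ _ => trivial)).comp hΦ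
  exact (continuousOn_iff_continuous_domRestrict.2 hcomp).continuousAt
    (Metric.closedBall_mem_nhds h₀ one_pos)

/-! ### Convolution of test functions and distributions -/

theorem iteratedFDeriv_convolution {d : ℕ} {ψ φ : Rd d → ℝ} (hψ : LocallyIntegrable ψ)
    (hφ : ContDiff ℝ ∞ φ) (hc : HasCompactSupport φ) (i : ℕ) (x : Rd d) :
    iteratedFDeriv ℝ i (convolution ψ φ (ContinuousLinearMap.lsmul ℝ ℝ) volume) x =
      ∫ h, ψ h • iteratedFDeriv ℝ i φ (x - h) := by
  induction i generalizing x with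
  | zero =>
    simp only [iteratedFDeriv_zero_eq_comp, Function.comp_apply, convolution,
      ContinuousLinearMap.lsmul_apply]
    let I := (continuousMultilinearCurryFin0 ℝ (Rd d) ℝ).symm.toContinuousLinearEquiv
    change I _ = ∫ h, ψ h • I _
    simp only [← map_smul]
    exact (I.integral_comp_comm _).symm
  | succ i ih =>
    have hfun : iteratedFDeriv ℝ i (convolution ψ φ (ContinuousLinearMap.lsmul ℝ ℝ) volume) =
        convolution ψ (iteratedFDeriv ℝ i φ) (ContinuousLinearMap.lsmul ℝ ℝ) volume :=
      funext ih
    have hd : ContDiff ℝ 1 (iteratedFDeriv ℝ i φ) :=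
      hφ.iteratedFDeriv_right (by exact_mod_cast le_top)
    have h := ((hc.iteratedFDeriv (𝕜 := ℝ) i).hasFDerivAt_convolution_right
      (ContinuousLinearMap.lsmul ℝ ℝ) hψ hd x).fderiv
    simp only [iteratedFDeriv_succ_eq_comp_left, Function.comp_apply]
    rw [hfun, h]
    let I : (Rd d →L[ℝ] (Rd d [×i]→L[ℝ] ℝ)) ≃L[ℝ] (Rd d [×(i + 1)]→L[ℝ] ℝ) :=
      (continuousMultilinearCurryLeftEquiv ℝ
        (fun _ : Fin (i + 1) => Rd d) ℝ).symm.toContinuousLinearEquiv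
    change I _ = ∫ h, ψ h • I _
    simp only [← map_smul]
    exact (ContinuousLinearEquiv.integral_comp_comm (𝕜 := ℝ) (E := Rd d →L[ℝ] (Rd d [×i]→L[ℝ] ℝ))
      (F := Rd d [×(i + 1)]→L[ℝ] ℝ) (μ := volume) I
      fun h => ψ h • fderiv ℝ (iteratedFDeriv ℝ i φ) (x - h)).symm

/-- The space of bounded continuous functions on `ℝ^d` in which the derivatives of order `i` of
test functions live. -/
def DerivSpace (d i : ℕ) : Type := Rd d →ᵇ (Rd d [×i]→L[ℝ] ℝ)

instance (d i : ℕ) : NormedAddCommGroup (DerivSpace d i) :=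
  inferInstanceAs (NormedAddCommGroup (Rd d →ᵇ (Rd d [×i]→L[ℝ] ℝ)))

instance (d i : ℕ) : NormedSpace ℝ (DerivSpace d i) :=
  inferInstanceAs (NormedSpace ℝ (Rd d →ᵇ (Rd d [×i]→L[ℝ] ℝ)))

instance (d i : ℕ) : CompleteSpace (DerivSpace d i) :=
  inferInstanceAs (CompleteSpace (Rd d →ᵇ (Rd d [×i]→L[ℝ] ℝ)))

/-- Evaluation at a point on `DerivSpace d i`. -/
def DerivSpace.eval {d : ℕ} (i : ℕ) (x : Rd d) : DerivSpace d i →L[ℝ] (Rd d [×i]→L[ℝ] ℝ) :=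
  BoundedContinuousFunction.evalCLM ℝ x

theorem DerivSpace.ext {d i : ℕ} {u v : DerivSpace d i} (h : ∀ x, eval i x u = eval i x v) :
    u = v :=
  BoundedContinuousFunction.ext h

/-- The derivative of order `i` on `𝓓_K`. -/
def derivMap {d : ℕ} (K : Compacts (Rd d)) (i : ℕ) : 𝓓_{K}(Rd d, ℝ) →L[ℝ] DerivSpace d i :=
  ContDiffMapSupportedIn.structureMapCLM ℝ ⊤ i

theorem eval_derivMap {d : ℕ} {K : Compacts (Rd d)} (i : ℕ) (u : 𝓓_{K}(Rd d, ℝ)) (x : Rd d) :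
    DerivSpace.eval i x (derivMap K i u) = iteratedFDeriv ℝ i u x :=
  congrFun (ContDiffMapSupportedIn.structureMapCLM_top_apply ℝ u) x

/-- A continuous functional on `𝓓_K` factors through finitely many derivatives. -/
theorem exists_factor_derivMap {d : ℕ} {K : Compacts (Rd d)}
    (L : 𝓓_{K}(Rd d, ℝ) →L[ℝ] ℝ) :
    ∃ (s : Finset ℕ) (g : (Π i : s, DerivSpace d i) →L[ℝ] ℝ),
      ∀ u, L u = g fun i => derivMap K i u := by
  obtain ⟨s, C, -, hC⟩ := Seminorm.bound_of_continuous
    (ContDiffMapSupportedIn.withSeminorms ℝ (Rd d) ℝ ⊤ K)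
    ((normSeminorm ℝ ℝ).comp (L : 𝓓_{K}(Rd d, ℝ) →ₗ[ℝ] ℝ)) (L.continuous.norm)
  let ι : 𝓓_{K}(Rd d, ℝ) →ₗ[ℝ] (Π i : s, DerivSpace d i) :=
    LinearMap.pi fun i => (derivMap K i : 𝓓_{K}(Rd d, ℝ) →ₗ[ℝ] _)
  have hbound : ∀ u, ‖L u‖ ≤ C * ‖ι u‖ := by
    intro u
    refine (hC u).trans ?_
    refine mul_le_mul_of_nonneg_left ?_ C.2
    refine Seminorm.finset_sup_apply_le (norm_nonneg _) fun i hi => ?_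
    exact norm_le_pi_norm (ι u) ⟨i, hi⟩
  have hker : LinearMap.ker ι ≤ LinearMap.ker (L : 𝓓_{K}(Rd d, ℝ) →ₗ[ℝ] ℝ) := by
    intro u hu
    have := hbound u
    rw [LinearMap.mem_ker.1 hu, norm_zero, mul_zero] at this
    exact norm_le_zero_iff.1 this
  let g₀ : LinearMap.range ι →ₗ[ℝ] ℝ :=
    (LinearMap.ker ι).liftQ (L : 𝓓_{K}(Rd d, ℝ) →ₗ[ℝ] ℝ) hker ∘ₗ
      ι.quotKerEquivRange.symm.toLinearMap
  have hg₀ : ∀ u, g₀ ⟨ι u, u, rfl⟩ = L u := by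
    intro u
    have : ι.quotKerEquivRange.symm ⟨ι u, u, rfl⟩ = (LinearMap.ker ι).mkQ u :=
      ι.quotKerEquivRange_symm_apply_image u _
    simp [g₀, this]
  -- Hahn–Banach extends the functional from the range of `ι` to the whole product.
  obtain ⟨g, hg, -⟩ := exists_extension_norm_eq (LinearMap.range ι)
    (g₀.mkContinuous C (by
      rintro ⟨_, u, rfl⟩
      rw [hg₀]
      exact hbound u))
  refine ⟨s, g, fun u => ?_⟩
  rw [← hg₀ u]
  exact (hg ⟨ι u, u, rfl⟩).symm

/-- The convolution of two test functions. -/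
def testConv {d : ℕ} (ψ φ : Test d) : Test d where
  toFun := convolution ψ φ (ContinuousLinearMap.lsmul ℝ ℝ) volume
  contDiff' := φ.hasCompactSupport.contDiff_convolution_right _
    ψ.continuous.locallyIntegrable φ.contDiff
  hasCompactSupport' := ψ.hasCompactSupport.convolution _ φ.hasCompactSupport
  tsupport_subset' := fun _ _ => trivial

theorem testConv_comm {d : ℕ} (ψ φ : Test d) : testConv ψ φ = testConv φ ψ := by
  ext x
  change convolution ψ φ _ volume x = convolution φ ψ _ volume x
  rw [convolution_lsmul_swap]
  simp only [convolution, ContinuousLinearMap.lsmul_apply, smul_eq_mul, mul_comm]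

open Pointwise in
/-- Fubini's theorem for the pairing of a distribution with a convolution. -/
theorem dist_testConv {d : ℕ} (f : Distr d) (ψ φ : Test d) :
    f (testConv ψ φ) = ∫ h, ψ h * f (testTranslate (-h) φ) := by
  have hKc : IsCompact (tsupport ψ + tsupport φ) :=
    ψ.hasCompactSupport.isCompact.add φ.hasCompactSupport.isCompact
  let K : Compacts (Rd d) := ⟨_, hKc⟩
  have hconv : Function.support (testConv ψ φ) ⊆ K :=
    (support_convolution_subset _).trans
      (Set.add_subset_add (subset_tsupport _) (subset_tsupport _))
  have htrans : ∀ h ∈ tsupport ψ, Function.support (testTranslate (-h) φ) ⊆ K := by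
    intro h hh x hx
    exact ⟨h, hh, x + -h, subset_tsupport _ hx, add_neg_cancel_comm_assoc _ _⟩
  let j : 𝓓_{K}(Rd d, ℝ) →L[ℝ] Test d :=
    TestFunction.ofSupportedInCLM ℝ (Ω := (⊤ : Opens (Rd d))) (fun _ _ => trivial)
  let L : 𝓓_{K}(Rd d, ℝ) →L[ℝ] ℝ :=
    ⟨(f : Test d →ₗ[ℝ] ℝ) ∘ₗ (j : 𝓓_{K}(Rd d, ℝ) →ₗ[ℝ] Test d),
      (map_continuous f).comp j.continuous⟩
  -- On `𝓓_K` the distribution becomes a functional `g` on a Banach space, where it commutes with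
  -- the Bochner integral of `ψ h • J h`; `J h` records the derivatives of the translate of `φ`.
  obtain ⟨s, g, hg⟩ := exists_factor_derivMap L
  have hG : ∀ i : ℕ, Continuous (iteratedFDeriv ℝ i φ) := fun i =>
    φ.contDiff.continuous_iteratedFDeriv (by exact_mod_cast le_top)
  have hc : ∀ i : ℕ, HasCompactSupport (iteratedFDeriv ℝ i φ) := fun i =>
    φ.hasCompactSupport.iteratedFDeriv i
  let J : Rd d → Π i : s, DerivSpace d i := fun h i =>
    boundedTranslate (hG i) (hc i) (-h)
  have hJ : Continuous J := continuous_pi fun i =>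
    (continuous_boundedTranslate (hG i) (hc i)).comp continuous_neg
  have hint : Integrable fun h => ψ h • J h :=
    (ψ.continuous.smul hJ).integrable_of_hasCompactSupport ψ.hasCompactSupport.smul_right
  have h1 : ∀ h, ψ h * f (testTranslate (-h) φ) = g (ψ h • J h) := by
    intro h
    by_cases hh : h ∈ tsupport ψ
    · let u : 𝓓_{K}(Rd d, ℝ) :=
        .of_support_subset (testTranslate (-h) φ).contDiff (htrans h hh)
      have hu : f (testTranslate (-h) φ) = L u := rfl
      rw [hu, hg, map_smul, smul_eq_mul]
      congr 2
      funext i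
      refine DerivSpace.ext fun x => ?_
      rw [eval_derivMap]
      exact iteratedFDeriv_comp_add_right (i : ℕ) (-h) x
    · rw [image_eq_zero_of_notMem_tsupport hh, zero_smul, map_zero, zero_mul]
  simp_rw [h1]
  rw [g.integral_comp_comm hint]
  let w : 𝓓_{K}(Rd d, ℝ) := .of_support_subset (testConv ψ φ).contDiff hconv
  have hw : f (testConv ψ φ) = L w := rfl
  rw [hw, hg]
  congr 1
  funext i
  refine DerivSpace.ext fun x => ?_
  rw [eval_derivMap]
  -- Point evaluations identify the Bochner integral with the derivatives of the convolution.
  let ev : (Π i : s, DerivSpace d i) →L[ℝ] (Rd d [×i]→L[ℝ] ℝ) :=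
    DerivSpace.eval i x ∘L ContinuousLinearMap.proj i
  have h2 := ev.integral_comp_comm hint
  refine (iteratedFDeriv_convolution ψ.continuous.locallyIntegrable φ.contDiff
    φ.hasCompactSupport i x).trans (Eq.trans ?_ h2)
  refine integral_congr_ae (Filter.Eventually.of_forall fun h => ?_)
  simp only [map_smul, sub_eq_add_neg]
  rfl

/-! ### Distributions -/

theorem distIsPolynomial_of_invariant {d : ℕ} (hd : 2 ≤ d) {V : Submodule ℝ (Distr d)}
    [FiniteDimensional ℝ V] (hV : ∀ h, ∀ f ∈ V, distTranslate h f ∈ V)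
    (hO : ∀ P ∈ specialOrthogonalSubgroup d, ∀ f ∈ V, distO P f ∈ V) {f : Distr d}
    (hf : f ∈ V) : DistIsPolynomial f := by
  let T : Rd d → V →ₗ[ℝ] V := fun h => LinearMap.restrict
    { toFun := distTranslate h, map_add' := fun _ _ => rfl, map_smul' := fun _ _ => rfl } (hV h)
  let ev : Test d → Module.Dual ℝ V := fun φ =>
    { toFun := fun f => f.1 φ, map_add' := fun _ _ => rfl, map_smul' := fun _ _ => rfl }
  have hev : ∀ {v w : V}, (∀ φ, v.1 φ = w.1 φ) → v = w := fun h =>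
    Subtype.ext (ContinuousLinearMap.ext h)
  let R : ∀ P ∈ specialOrthogonalSubgroup d, V →ₗ[ℝ] V := fun P hP => LinearMap.restrict
    { toFun := distO P
      map_add' := fun _ _ => ContinuousLinearMap.ext fun _ => mul_add _ _ _
      map_smul' := fun _ _ => ContinuousLinearMap.ext fun _ => mul_left_comm _ _ _ } (hO P hP)
  have hRapply : ∀ P (hP : P ∈ specialOrthogonalSubgroup d) (v : V) (φ : Test d),
      (R P hP v).1 φ = v.1 (testO P⁻¹ φ) := by
    intro P hP v φ
    change distO P v.1 φ = _
    rw [distO_apply, ((mem_specialOrthogonalSubgroup P).1 hP).2, abs_one, inv_one, one_mul]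
  have hR : ∀ P hP hP', R P hP * R P⁻¹ hP' = 1 := fun P hP hP' => by
    refine LinearMap.ext fun v => hev fun φ => ?_
    change (R P hP (R P⁻¹ hP' v)).1 φ = v.1 φ
    rw [hRapply P hP, hRapply P⁻¹ hP', inv_inv]
    congr 1
    ext x
    exact congrArg φ ((glEquiv P).symm_apply_apply x)
  have key := polynomial_and_average_of_representation hd (T := T) (S := Set.range ev)
    ?_ ?_ ?_ ?_ ?_
  · obtain ⟨ψ, w, hw⟩ := key.2 ⟨f, hf⟩
    obtain ⟨p, hp⟩ := key.1 (ev ψ) w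
    refine ⟨p, fun φ => ?_⟩
    calc f φ = ∫ h, ψ h * w.1 (testTranslate (-h) φ) := hw (ev φ)
      _ = w.1 (testConv ψ φ) := (dist_testConv w.1 ψ φ).symm
      _ = w.1 (testConv φ ψ) := by rw [testConv_comm]
      _ = ∫ h, φ h * w.1 (testTranslate (-h) ψ) := dist_testConv w.1 φ ψ
      _ = _ := by
        refine integral_congr_ae (Filter.Eventually.of_forall fun h => ?_)
        simp only [← hp h, mul_comm (φ h)]
        rfl
  · intro v hv
    exact hev fun φ => hv (ev φ) ⟨φ, rfl⟩
  · rintro _ ⟨φ, rfl⟩ v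
    change Continuous fun h => v.1 (testTranslate (-h) φ)
    exact (map_continuous v.1).comp ((continuous_testTranslate φ).comp continuous_neg)
  · refine LinearMap.ext fun v => hev fun φ => ?_
    change v.1 (testTranslate (-0) φ) = v.1 φ
    congr 1
    ext x
    rw [testTranslate_apply, neg_zero, add_zero]
  · intro h k
    refine LinearMap.ext fun v => hev fun φ => ?_
    change v.1 (testTranslate (-(h + k)) φ) = v.1 (testTranslate (-k) (testTranslate (-h) φ))
    congr 1
    ext x
    simp only [testTranslate_apply]
    congr 1
    abel
  · intro P hP
    have hP' := inv_mem hP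
    refine ⟨R P⁻¹ hP', ?_, fun h => ?_⟩
    · refine ⟨⟨R P⁻¹ hP', R P hP, ?_, hR P hP hP'⟩, rfl⟩
      have := hR P⁻¹ hP' (by rwa [inv_inv])
      simpa only [inv_inv] using this
    · refine LinearMap.ext fun v => hev fun φ => ?_
      change (R P⁻¹ hP' (T h v)).1 φ = (R P⁻¹ hP' v).1 (testTranslate (-glEquiv P h) φ)
      rw [hRapply P⁻¹ hP', hRapply P⁻¹ hP', inv_inv]
      change v.1 (testTranslate (-h) (testO P φ)) = _
      congr 1
      ext x
      simp only [testTranslate_apply, testO_apply, map_add, map_neg]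

end InvariantPoly

end

theorem theorem2p8 (d : ℕ) (hd : 2 ≤ d) (G : Subgroup (GL (Fin d) ℝ))
    (hG : G = InvariantPoly.specialOrthogonalSubgroup d ∨
      G = InvariantPoly.orthogonalSubgroup d) :
    (∀ V : Submodule ℝ (InvariantPoly.ContFun d), FiniteDimensional ℝ V →
      (∀ h : InvariantPoly.Rd d, ∀ f ∈ V, InvariantPoly.contTranslate h f ∈ V) →
      (∀ P ∈ G, ∀ f ∈ V, InvariantPoly.contO P f ∈ V) →
      ∀ f ∈ V, InvariantPoly.ContIsPolynomial f) ∧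
    (∀ V : Submodule ℝ (InvariantPoly.Distr d), FiniteDimensional ℝ V →
      (∀ h : InvariantPoly.Rd d, ∀ f ∈ V, InvariantPoly.distTranslate h f ∈ V) →
      (∀ P ∈ G, ∀ f ∈ V, InvariantPoly.distO P f ∈ V) →
      ∀ f ∈ V, InvariantPoly.DistIsPolynomial f) := by
  -- Rotations alone suffice, so both groups reduce to `SO(d)`.
  have hle : InvariantPoly.specialOrthogonalSubgroup d ≤ G := by
    rcases hG with rfl | rfl
    · exact le_rfl
    · exact fun P hP => ((InvariantPoly.mem_specialOrthogonalSubgroup P).1 hP).1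
  exact ⟨fun V _ hV hO f hf =>
      InvariantPoly.contIsPolynomial_of_invariant hd hV (fun P hP => hO P (hle hP)) hf,
    fun V _ hV hO f hf =>
      InvariantPoly.distIsPolynomial_of_invariant hd hV (fun P hP => hO P (hle hP)) hf⟩
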